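/- Let $I$ be a finite non-empty set of agents. Formulas are built from propositional variables $p_0,p_1,\dots$ and $\bot$ by $\to$, $\Box_i$ ($i\in I$) and $\mathsf C$; the abbreviations are $\neg\varphi:=\varphi\to\bot$, $\top:=\neg\bot$, $\varphi\wedge\psi:=\neg(\varphi\to\neg\psi)$ and $\mathsf E\varphi:=\bigwedge_{i\in I}\Box_i\varphi$. The logic $\mathsf{S4}^C_I$ is given by the Hilbert calculus whose axioms are all instances of classical propositional tautologies together with $$\Box_i(\varphi\to\psi)\to(\Box_i\varphi\to\Box_i\psi),\qquad \Box_i\varphi\to\Box_i\Box_i\varphi,\qquad \Box_i\varphi\to\varphi,$$ $$\mathsf C(\varphi\to\psi)\to(\mathsf C\varphi\to\mathsf C\psi),\qquad \mathsf C\varphi\to(\mathsf E\varphi\wedge\mathsf E\mathsf C\varphi),\qquad (\mathsf E\varphi\wedge\mathsf C(\varphi\to\mathsf E\varphi))\to\mathsf C\varphi,$$ and whose rules are modus ponens (mp: from $\varphi$ and $\varphi\to\psi$ infer $\psi$) and necessitation (nec: from $\varphi$ infer $\mathsf C\varphi$). Write $\mathsf{S4}^C_I\vdash\varphi$ if $\varphi$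 is derivable in this calculus. An $\omega$-derivation is a well-founded tree of formulas built according to (mp), (nec) and the infinitary rule $$(\omega)\qquad\text{from } \varphi_n\to(\mathsf E\psi\wedge\mathsf E\varphi_{n+1})\ \text{ for all } n\in\mathbb N,\ \text{ infer } \varphi_0\to\mathsf C\psi .$$ An assumption leaf is a leaf that is not marked by an axiom of $\mathsf{S4}^C_I$. For a set $\Sigma$ of formulas, write $\Sigma\vdash_g\varphi$ if there is an $\omega$-derivation with root $\varphi$ all of whose assumption leaves are marked by elements of $\Sigma$. Proposition. For every formula $\varphi$, $$\mathsf{S4}^C_I\vdash\varphi\iff\emptyset\vdash_g\varphi .$$ Equivalently, the rule $(\omega)$ is admissible in $\mathsf{S4}^C_I$: for all formulas $\psi$ and $\varphi_0,\varphi_1,\dots$, if $\mathsf{S4}^C_I\vdash\varphi_n\to(\mathsf E\psi\wedge\mathsf E\varphi_{n+1})$ for every $n\in\mathbb N$, then $\mathsf{S4}^C_I\vdash\varphi_0\to\mathsf C\psi$. -/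

import Mathlib

namespace S4C

universe u

/-- Formulas of the logic of common knowledge over a set `I` of agents, built from the
propositional variables `p₀, p₁, …` and `⊥` by `→`, `□ᵢ` (for `i : I`) and `C`. -/
inductive Formula (I : Type u) : Type u
  | var : ℕ → Formula I
  | bot : Formula I
  | imp : Formula I → Formula I → Formula I
  | box : I → Formula I → Formula I
  | common : Formula I → Formula I

namespace Formula

variable {I : Type u}

/-- `¬ φ := φ → ⊥`. -/
def neg (φ : Formula I) : Formula I := imp φ bot

/-- `⊤ := ¬ ⊥`. -/
def top : Formula I := neg bot

/-- `φ ∧ ψ := ¬ (φ → ¬ ψ)`. -/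
def and (φ ψ : Formula I) : Formula I := neg (imp φ (neg ψ))

/-- Conjunction of a finite list of formulas, bracketed to the right:
the conjunction of `[φ]` is `φ` itself, and the empty conjunction is `⊤`. -/
def conj : List (Formula I) → Formula I
  | [] => top
  | [φ] => φ
  | φ :: ψ :: l => and φ (conj (ψ :: l))

/-- Mutual knowledge, `E φ := ⋀_{i ∈ I} □ᵢ φ`, with the conjuncts taken in a fixed order of `I`. -/
noncomputable def everyone [Fintype I] (φ : Formula I) : Formula I :=
  conj ((Finset.univ : Finset I).toList.map fun i => box i φ)

/-- A Boolean valuation: it respects `⊥` and `→`, and is arbitrary on propositional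
variables and on formulas of the form `□ᵢ φ` and `C φ`, which it treats as atoms. -/
structure IsBooleanValuation (v : Formula I → Prop) : Prop where
  bot : ¬ v bot
  imp : ∀ φ ψ : Formula I, v (imp φ ψ) ↔ (v φ → v ψ)

/-- `φ` is (an instance in the modal language of) a tautology of classical propositional logic. -/
def IsTautology (φ : Formula I) : Prop :=
  ∀ v : Formula I → Prop, IsBooleanValuation v → v φ

end Formula

open Formula

/-- The axioms of `S4^C_I`. -/
inductive IsAxiom {I : Type u} [Fintype I] : Formula I → Prop
  | taut (φ : Formula I) : IsTautology φ → IsAxiom φ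
  | boxK (i : I) (φ ψ : Formula I) :
      IsAxiom (imp (box i (imp φ ψ)) (imp (box i φ) (box i ψ)))
  | boxFour (i : I) (φ : Formula I) : IsAxiom (imp (box i φ) (box i (box i φ)))
  | boxT (i : I) (φ : Formula I) : IsAxiom (imp (box i φ) φ)
  | commonK (φ ψ : Formula I) :
      IsAxiom (imp (common (imp φ ψ)) (imp (common φ) (common ψ)))
  | commonFix (φ : Formula I) :
      IsAxiom (imp (common φ) (and (everyone φ) (everyone (common φ))))
  | commonInd (φ : Formula I) :
      IsAxiom (imp (and (everyone φ) (common (imp φ (everyone φ)))) (common φ))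

/-- Theorems of the Hilbert calculus `S4^C_I`, with the rules `mp` and `nec`. -/
inductive Provable {I : Type u} [Fintype I] : Formula I → Prop
  | ax (φ : Formula I) : IsAxiom φ → Provable φ
  | mp (φ ψ : Formula I) : Provable φ → Provable (imp φ ψ) → Provable ψ
  | nec (φ : Formula I) : Provable φ → Provable (common φ)

/-- `OmegaDerivation φ` is the type of `ω`-derivations whose root is marked by `φ`: well-founded
trees, possibly infinitely branching, whose leaves are marked by arbitrary formulas and whose
inner nodes are instances of `mp`, `nec` or the infinitary rule `ω`. -/
inductive OmegaDerivation {I : Type u} [Fintype I] : Formula I → Type u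
  | leaf (φ : Formula I) : OmegaDerivation φ
  | mp (φ ψ : Formula I) :
      OmegaDerivation φ → OmegaDerivation (imp φ ψ) → OmegaDerivation ψ
  | nec (φ : Formula I) : OmegaDerivation φ → OmegaDerivation (common φ)
  | omega (φ : ℕ → Formula I) (ψ : Formula I) :
      (∀ n : ℕ, OmegaDerivation (imp (φ n) (and (everyone ψ) (everyone (φ (n + 1)))))) →
      OmegaDerivation (imp (φ 0) (common ψ))

/-- The set of formulas that mark the assumption leaves of an `ω`-derivation, that is,
the leaves that are not marked by an axiom. -/
def OmegaDerivation.assumptions {I : Type u} [Fintype I] :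
    {φ : Formula I} → OmegaDerivation φ → Set (Formula I)
  | _, .leaf φ => {χ | χ = φ ∧ ¬ IsAxiom φ}
  | _, .mp _ _ d e => d.assumptions ∪ e.assumptions
  | _, .nec _ d => d.assumptions
  | _, .omega _ _ d => ⋃ n, (d n).assumptions

/-- `S ⊢_g φ`: there is an `ω`-derivation of `φ` in which all assumption leaves are marked
by elements of `S`. -/
def GlobalDerivable {I : Type u} [Fintype I] (S : Set (Formula I)) (φ : Formula I) : Prop :=
  ∃ d : OmegaDerivation φ, d.assumptions ⊆ S

end S4C

/-!
The implication from left to right is immediate, since every Hilbert proof is an `ω`-derivation.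
The converse, and with it the admissibility of `ω`, is proved semantically. In a Kripke model with
reflexive and transitive relations in which `C` quantifies over the worlds reachable in at least
one step, `ω` is sound: if `φ 0` holds at `w`, then the premises carry `φ n` and `ψ` along every
path that starts at `w`. So every formula `ω`-derivable from no assumptions is valid
(`GlobalDerivable.sat`), and it remains to prove that valid formulas are provable.

The logic is not compact, so the canonical model must be modified. The worlds
are the Boolean valuations that make all theorems true, i.e. the maximal consistent sets. For a
finite set `Γ` of formulas, agent `i` considers `w` possible at `v` if all formulas `□ᵢ φ ∈ Γ` true
at `v` are true at `w`. This is filtration without passing to the quotient: which worlds are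
reachable from `v` depends only on the restriction of `v` to the finite set `Γ`, and so the worlds
from which only worlds satisfying `χ` are reachable are exactly those that satisfy some formula `θ`
(`exists_defining_formula`). Both `θ → E θ` and `θ → χ` are then theorems, and the induction axiom
yields `θ → C χ`, which is the difficult case of the truth lemma (`truth_lemma`).
-/

namespace S4C

universe u

open Formula

variable {I : Type u}

/-! ### Boolean valuations -/

namespace Formula.IsBooleanValuation

variable {v : Formula I → Prop}

theorem neg_iff (hv : IsBooleanValuation v) (φ : Formula I) : v (neg φ) ↔ ¬ v φ := by
  simp only [neg, hv.imp, hv.bot, imp_false]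

theorem and_iff (hv : IsBooleanValuation v) (φ ψ : Formula I) :
    v (and φ ψ) ↔ v φ ∧ v ψ := by
  simp only [and, hv.neg_iff, hv.imp]
  tauto

theorem conj_iff (hv : IsBooleanValuation v) (l : List (Formula I)) :
    v (conj l) ↔ ∀ φ ∈ l, v φ := by
  induction l with
  | nil => simp [conj, top, hv.neg_iff, hv.bot]
  | cons φ l ih =>
    cases l with
    | nil => simp [conj]
    | cons ψ l => rw [conj, hv.and_iff, ih, List.forall_mem_cons (p := v) (a := φ)]

theorem everyone_iff [Fintype I] (hv : IsBooleanValuation v) (φ : Formula I) :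
    v (everyone φ) ↔ ∀ i, v (box i φ) := by
  simp [everyone, hv.conj_iff]

end Formula.IsBooleanValuation

/-- Every property of the finite set of true members of `Γ` is expressed by a formula. -/
theorem exists_defining_formula {Γ : Set (Formula I)} (hΓ : Γ.Finite)
    (Q : Set (Formula I) → Prop) :
    ∃ θ, ∀ v : Formula I → Prop, IsBooleanValuation v → (v θ ↔ Q {φ ∈ Γ | v φ}) := by
  induction Γ, hΓ using Set.Finite.induction_on generalizing Q with
  | empty =>
    by_cases h : Q ∅
    · exact ⟨top, fun v hv => by simp [top, hv.neg_iff, hv.bot, h]⟩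
    · exact ⟨bot, fun v hv => by simp [hv.bot, h]⟩
  | @insert φ Γ _ _ ih =>
    obtain ⟨θ₁, h₁⟩ := ih fun S => Q (insert φ S)
    obtain ⟨θ₂, h₂⟩ := ih Q
    refine ⟨and (imp φ θ₁) (imp (neg φ) θ₂), fun v hv => ?_⟩
    rw [hv.and_iff, hv.imp, hv.imp, hv.neg_iff, h₁ v hv, h₂ v hv]
    by_cases hφ : v φ
    · have : {χ ∈ insert φ Γ | v χ} = insert φ {χ ∈ Γ | v χ} := by
        ext χ
        simp only [Set.mem_insert_iff, Set.mem_ofPred_eq]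
        constructor
        · tauto
        · rintro (rfl | h) <;> tauto
      simp only [this, hφ, not_true_eq_false, true_imp_iff, false_imp_iff, and_true]
    · have : {χ ∈ insert φ Γ | v χ} = {χ ∈ Γ | v χ} := by
        ext χ
        simp only [Set.mem_insert_iff, Set.mem_ofPred_eq]
        constructor
        · rintro ⟨rfl | h, h'⟩ <;> tauto
        · tauto
      simp only [this, hφ, not_false_eq_true, true_imp_iff, false_imp_iff, true_and]

/-! ### The Fischer–Ladner closure -/

/-- The Fischer–Ladner closure of a formula: its subformulas, and `□ᵢ C χ` for every agent `i` and
every subformula `C χ`. -/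
def closure : Formula I → Set (Formula I)
  | var n => {var n}
  | bot => {bot}
  | imp φ ψ => insert (imp φ ψ) (closure φ ∪ closure ψ)
  | box i φ => insert (box i φ) (closure φ)
  | common φ => insert (common φ) (Set.range (fun i => box i (common φ)) ∪ closure φ)

theorem finite_closure [Finite I] (φ : Formula I) : (closure φ).Finite := by
  induction φ with
  | var n => exact Set.finite_singleton _
  | bot => exact Set.finite_singleton _
  | imp φ ψ ih₁ ih₂ => exact (ih₁.union ih₂).insert _
  | box i φ ih => exact ih.insert _
  | common φ ih => exact ((Set.finite_range _).union ih).insert _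

theorem self_mem_closure (φ : Formula I) : φ ∈ closure φ := by
  cases φ <;> simp [closure]

/-! ### Kripke semantics and soundness -/

/-- A Kripke model for the agents in `I` whose accessibility relations are reflexive and
transitive. -/
structure KripkeModel (I : Type u) where
  /-- The type of worlds. -/
  World : Type u
  /-- The accessibility relation of an agent. -/
  rel : I → World → World → Prop
  /-- The valuation of the propositional variables. -/
  val : ℕ → World → Prop
  refl : ∀ i w, rel i w w
  trans : ∀ i w₁ w₂ w₃, rel i w₁ w₂ → rel i w₂ w₃ → rel i w₁ w₃

namespace KripkeModel

variable (M : KripkeModel I)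

/-- Reachability by a path of length at least one, each step being along the relation of some
agent. -/
def Reach : M.World → M.World → Prop :=
  Relation.TransGen fun w u => ∃ i, M.rel i w u

/-- `M.Sat w φ`: the formula `φ` is true at the world `w` of `M`. -/
def Sat (w : M.World) : Formula I → Prop
  | var n => M.val n w
  | bot => False
  | imp φ ψ => Sat w φ → Sat w ψ
  | box i φ => ∀ u, M.rel i w u → Sat u φ
  | common φ => ∀ u, M.Reach w u → Sat u φ

theorem isBooleanValuation_sat (w : M.World) : IsBooleanValuation (M.Sat w) :=
  ⟨by simp [Sat], fun φ ψ => by simp [Sat]⟩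

theorem sat_everyone [Fintype I] {w : M.World} {φ : Formula I} :
    M.Sat w (everyone φ) ↔ ∀ i u, M.rel i w u → M.Sat u φ := by
  simp [(M.isBooleanValuation_sat w).everyone_iff, Sat]

theorem sat_and {w : M.World} {φ ψ : Formula I} :
    M.Sat w (and φ ψ) ↔ M.Sat w φ ∧ M.Sat w ψ :=
  (M.isBooleanValuation_sat w).and_iff φ ψ

theorem sat_of_isAxiom [Fintype I] {φ : Formula I} (h : IsAxiom φ) (w : M.World) :
    M.Sat w φ := by
  cases h with
  | taut _ h => exact h _ (M.isBooleanValuation_sat w)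
  | boxK i φ ψ => exact fun h h' u hu => h u hu (h' u hu)
  | boxFour i φ => exact fun h u hu t ht => h t (M.trans i w u t hu ht)
  | boxT i φ => exact fun h => h w (M.refl i w)
  | commonK φ ψ => exact fun h h' u hu => h u hu (h' u hu)
  | commonFix φ =>
    refine fun h => M.sat_and.2 ⟨M.sat_everyone.2 fun i u hu => h u (.single ⟨i, hu⟩),
      M.sat_everyone.2 fun i u hu t ht => h t (.head ⟨i, hu⟩ ht)⟩
  | commonInd φ =>
    intro h u hu
    obtain ⟨h₀, h₁⟩ := M.sat_and.1 h
    induction hu with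
    | single hu => exact hu.elim fun i hi => M.sat_everyone.1 h₀ i _ hi
    | tail hwb hbc ih => exact hbc.elim fun i hi => M.sat_everyone.1 (h₁ _ hwb ih) i _ hi

theorem sat_omega [Fintype I] {φ : ℕ → Formula I} {ψ : Formula I}
    (h : ∀ n w, M.Sat w (imp (φ n) (and (everyone ψ) (everyone (φ (n + 1))))))
    (w : M.World) : M.Sat w (imp (φ 0) (common ψ)) := by
  intro h₀ u hu
  -- Along a path, the index `n` counts the steps made so far.
  suffices H : M.Sat u ψ ∧ ∃ n, M.Sat u (φ n) from H.1
  have step (n : ℕ) {w u : M.World} (hw : M.Sat w (φ n)) (hwu : ∃ i, M.rel i w u) :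
      M.Sat u ψ ∧ ∃ n, M.Sat u (φ n) := by
    obtain ⟨i, hi⟩ := hwu
    obtain ⟨hψ, hφ⟩ := M.sat_and.1 (h n w hw)
    exact ⟨M.sat_everyone.1 hψ i u hi, n + 1, M.sat_everyone.1 hφ i u hi⟩
  induction hu with
  | single hu => exact step 0 h₀ hu
  | tail _ hbc ih => exact ih.2.elim fun n hn => step n hn hbc

end KripkeModel

theorem GlobalDerivable.sat [Fintype I] {φ : Formula I}
    (h : GlobalDerivable (∅ : Set (Formula I)) φ) (M : KripkeModel I) (w : M.World) :
    M.Sat w φ := by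
  obtain ⟨d, hd⟩ := h
  induction d generalizing w with
  | leaf φ => exact M.sat_of_isAxiom (by_contra fun hφ => hd ⟨rfl, hφ⟩) w
  | mp φ ψ d e ihd ihe =>
    exact ihe w (Set.subset_union_right.trans hd) (ihd w (Set.subset_union_left.trans hd))
  | nec φ d ih => exact fun u _ => ih u hd
  | omega φ ψ d ih =>
    exact M.sat_omega (fun n w => ih n w ((Set.subset_iUnion _ n).trans hd)) w

/-! ### Maximal consistent sets -/

/-- A set of formulas that contains the tautologies and is closed under modus ponens. -/
structure IsTheory (T : Set (Formula I)) : Prop where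
  taut : ∀ φ, IsTautology φ → φ ∈ T
  mp : ∀ φ ψ, φ ∈ T → imp φ ψ ∈ T → ψ ∈ T

/-- The deduction theorem: the consequences of `χ` over a theory form a theory. -/
theorem IsTheory.adjoin {T : Set (Formula I)} (hT : IsTheory T) (χ : Formula I) :
    IsTheory {φ | imp χ φ ∈ T} where
  taut φ h := hT.taut _ fun v hv => (hv.imp _ _).2 fun _ => h v hv
  mp φ ψ h h' := by
    refine hT.mp _ _ h' (hT.mp _ _ h (hT.taut _ fun v hv => ?_))
    simp only [hv.imp]
    tauto

/-- Lindenbaum's lemma: a formula outside a theory is refuted by a Boolean valuation that makes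
the theory true. -/
theorem IsTheory.exists_valuation {T : Set (Formula I)} (hT : IsTheory T) {φ : Formula I}
    (hφ : φ ∉ T) :
    ∃ v : Formula I → Prop, IsBooleanValuation v ∧ (∀ ψ ∈ T, v ψ) ∧ ¬ v φ := by
  obtain ⟨M, hTM, hM⟩ := zorn_subset_nonempty {S | IsTheory S ∧ φ ∉ S} (by
    intro c hc hchain hne
    refine ⟨⋃₀ c, ⟨⟨fun ψ h => ?_, ?_⟩, ?_⟩, fun s hs => Set.subset_sUnion_of_mem hs⟩
    · obtain ⟨s, hs⟩ := hne
      exact ⟨s, hs, (hc hs).1.taut ψ h⟩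
    · rintro ψ χ ⟨s, hs, hψ⟩ ⟨t, ht, hχ⟩
      rcases hchain.total hs ht with h | h
      · exact ⟨t, ht, (hc ht).1.mp _ _ (h hψ) hχ⟩
      · exact ⟨s, hs, (hc hs).1.mp _ _ hψ (h hχ)⟩
    · rintro ⟨s, hs, h⟩
      exact (hc hs).2 h) T ⟨hT, hφ⟩
  obtain ⟨hMT, hMφ⟩ := hM.prop
  -- If `χ → φ` is not in `M`, adjoining `χ` to `M` does not yield `φ`, against maximality.
  have key (χ : Formula I) (hχ : χ ∉ M) : imp χ φ ∈ M := by
    by_contra hcon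
    refine hχ (hM.le_of_ge (y := {ψ | imp χ ψ ∈ M}) ⟨hMT.adjoin χ, hcon⟩ (fun ψ hψ => ?_) ?_)
    · exact hMT.mp _ _ hψ (hMT.taut _ fun v hv => by simp only [hv.imp]; tauto)
    · exact hMT.taut _ fun v hv => by simp only [hv.imp]; tauto
  refine ⟨fun ψ => ψ ∈ M, ⟨fun h => ?_, fun χ ψ => ⟨fun h h' => hMT.mp _ _ h' h, fun h => ?_⟩⟩,
    fun ψ hψ => hTM hψ, hMφ⟩
  · exact hMφ (hMT.mp _ _ h (hMT.taut _ fun v hv => (hv.imp _ _).2 fun hb => (hv.bot hb).elim))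
  · by_cases hχ : χ ∈ M
    · exact hMT.mp _ _ (h hχ) (hMT.taut _ fun v hv => by simp only [hv.imp]; tauto)
    · by_contra hcon
      -- As `χ ∨ (χ → ψ)` is a tautology, `(χ → ψ) → φ` and `χ → φ` imply `φ`.
      refine hMφ (hMT.mp _ _ (key _ hcon) (hMT.mp _ _ (key _ hχ) (hMT.taut _ fun v hv => ?_)))
      simp only [hv.imp]
      tauto

variable [Fintype I]

theorem isTheory_provable : IsTheory {φ : Formula I | Provable φ} :=
  ⟨fun φ h => .ax φ (.taut φ h), fun φ ψ h h' => .mp φ ψ h h'⟩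

/-- A maximal consistent set of formulas, encoded by its membership predicate. -/
structure CanonicalWorld (I : Type u) [Fintype I] where
  /-- Membership in the maximal consistent set. -/
  holds : Formula I → Prop
  bool : IsBooleanValuation holds
  provable : ∀ φ, Provable φ → holds φ

theorem provable_of_forall_holds {φ : Formula I} (h : ∀ w : CanonicalWorld I, w.holds φ) :
    Provable φ := by
  by_contra hφ
  obtain ⟨v, hv, hT, hvφ⟩ := isTheory_provable.exists_valuation hφ
  exact hvφ (h ⟨v, hv, hT⟩)

namespace CanonicalWorld

variable (w : CanonicalWorld I)

theorem holds_of_isAxiom {φ ψ : Formula I} (h : IsAxiom (imp φ ψ)) (hφ : w.holds φ) : w.holds ψ :=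
  (w.bool.imp _ _).1 (w.provable _ (.ax _ h)) hφ

theorem holds_of_common {φ : Formula I} (h : w.holds (common φ)) (i : I) :
    w.holds (box i φ) ∧ w.holds (box i (common φ)) := by
  have := w.holds_of_isAxiom (.commonFix φ) h
  rw [w.bool.and_iff, w.bool.everyone_iff, w.bool.everyone_iff] at this
  exact ⟨this.1 i, this.2 i⟩

/-- Necessitation for `□ᵢ`, derived from necessitation for `C`. -/
theorem holds_box_of_provable {φ : Formula I} (h : Provable φ) (i : I) : w.holds (box i φ) :=
  (w.holds_of_common (w.provable _ (.nec _ h)) i).1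

/-- The canonical successor also inherits all `□ᵢ ψ`, by the axiom `□ᵢ ψ → □ᵢ □ᵢ ψ`, so it is a
successor in every `filtratedModel`. -/
theorem exists_of_not_holds_box {i : I} {φ : Formula I} (h : ¬ w.holds (box i φ)) :
    ∃ u : CanonicalWorld I, (∀ ψ, w.holds (box i ψ) → u.holds (box i ψ)) ∧ ¬ u.holds φ := by
  have hT : IsTheory {ψ | w.holds (box i ψ)} :=
    ⟨fun ψ h => w.holds_box_of_provable (.ax _ (.taut _ h)) i,
      fun ψ χ hψ hχ => (w.bool.imp _ _).1 (w.holds_of_isAxiom (.boxK i ψ χ) hχ) hψ⟩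
  obtain ⟨v, hv, hTv, hvφ⟩ := hT.exists_valuation (φ := φ) h
  exact ⟨⟨v, hv, fun ψ hψ => hTv ψ (w.holds_box_of_provable hψ i)⟩,
    fun ψ hψ => hTv _ (w.holds_of_isAxiom (.boxFour i ψ) hψ), hvφ⟩

/-- The induction axiom in semantic form, for the invariant `θ`. -/
theorem holds_common_of_invariant {θ χ : Formula I}
    (hE : ∀ u : CanonicalWorld I, u.holds θ → ∀ i, u.holds (box i θ))
    (hχ : ∀ u : CanonicalWorld I, u.holds θ → u.holds χ) (hw : w.holds θ) :
    w.holds (common χ) := by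
  have h₁ : Provable (imp θ (everyone θ)) := provable_of_forall_holds fun u =>
    (u.bool.imp _ _).2 fun h => (u.bool.everyone_iff _).2 (hE u h)
  have h₂ : Provable (imp θ χ) := provable_of_forall_holds fun u => (u.bool.imp _ _).2 (hχ u)
  have hθ : w.holds (common θ) := w.holds_of_isAxiom (.commonInd θ)
    ((w.bool.and_iff _ _).2 ⟨(w.bool.everyone_iff _).2 (hE w hw), w.provable _ (.nec _ h₁)⟩)
  exact (w.bool.imp _ _).1 (w.holds_of_isAxiom (.commonK θ χ) (w.provable _ (.nec _ h₂))) hθ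

end CanonicalWorld

/-! ### The filtrated canonical model and completeness -/

/-- The model on the maximal consistent sets in which agent `i` considers `w` possible at `v` if
every `□ᵢ φ ∈ Γ` true at `v` is true at `w`. -/
def filtratedModel (Γ : Set (Formula I)) : KripkeModel I where
  World := CanonicalWorld I
  rel i v w := ∀ φ, box i φ ∈ Γ → v.holds (box i φ) → w.holds (box i φ)
  val n w := w.holds (var n)
  refl _ _ _ _ h := h
  trans _ _ _ _ h h' φ hφ hv := h' φ hφ (h φ hφ hv)

theorem filtratedModel_rel_congr {Γ : Set (Formula I)} {v v' w : CanonicalWorld I}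
    (h : {φ ∈ Γ | v.holds φ} = {φ ∈ Γ | v'.holds φ}) {i : I}
    (hr : (filtratedModel Γ).rel i v w) : (filtratedModel Γ).rel i v' w := fun φ hφ hv' =>
  hr φ hφ (h.symm.subset ⟨hφ, hv'⟩ : box i φ ∈ {φ ∈ Γ | v.holds φ}).2

theorem filtratedModel_reach_congr {Γ : Set (Formula I)} {v v' w : CanonicalWorld I}
    (h : {φ ∈ Γ | v.holds φ} = {φ ∈ Γ | v'.holds φ})
    (hr : (filtratedModel Γ).Reach v w) : (filtratedModel Γ).Reach v' w := by
  rcases (Relation.TransGen.head'_iff).1 hr with ⟨u, ⟨i, hi⟩, hu⟩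
  exact Relation.TransGen.head' ⟨i, filtratedModel_rel_congr h hi⟩ hu

/-- The part of the truth lemma that rests on the induction axiom. -/
theorem holds_common_of_forall_reach [Nonempty I] {Γ : Set (Formula I)} (hΓ : Γ.Finite)
    {w : CanonicalWorld I} {χ : Formula I}
    (h : ∀ u : CanonicalWorld I, (filtratedModel Γ).Reach w u → u.holds χ) :
    w.holds (common χ) := by
  obtain ⟨θ, hθ⟩ := exists_defining_formula hΓ fun S =>
    ∃ v : CanonicalWorld I, {φ ∈ Γ | v.holds φ} = S ∧
      ∀ u : CanonicalWorld I, (filtratedModel Γ).Reach v u → u.holds χ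
  have hθ' (v : CanonicalWorld I) :
      v.holds θ ↔ ∀ u : CanonicalWorld I, (filtratedModel Γ).Reach v u → u.holds χ := by
    rw [hθ _ v.bool]
    exact ⟨fun ⟨v', hv', H⟩ u hu => H u (filtratedModel_reach_congr hv'.symm hu),
      fun H => ⟨v, rfl, H⟩⟩
  refine w.holds_common_of_invariant (θ := θ) (fun v hv i => ?_) (fun v hv => ?_) ((hθ' w).2 h)
  · by_contra hcon
    obtain ⟨u, hu, hu'⟩ := v.exists_of_not_holds_box hcon
    exact hu' ((hθ' u).2 fun t ht => (hθ' v).1 hv t (.head ⟨i, fun φ _ => hu φ⟩ ht))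
  · -- `v` is reachable from itself in one step, as there is an agent.
    obtain ⟨i⟩ := ‹Nonempty I›
    exact (hθ' v).1 hv v (.single ⟨i, (filtratedModel Γ).refl i v⟩)

theorem truth_lemma [Nonempty I] {Γ : Set (Formula I)} (hΓ : Γ.Finite) {φ : Formula I}
    (hφ : closure φ ⊆ Γ) (w : CanonicalWorld I) :
    (filtratedModel Γ).Sat w φ ↔ w.holds φ := by
  induction φ generalizing w with
  | var n => rfl
  | bot => exact ⟨False.elim, w.bool.bot⟩
  | imp φ ψ ih₁ ih₂ =>
    obtain ⟨h₁, h₂⟩ := Set.union_subset_iff.1 ((Set.subset_insert _ _).trans hφ)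
    exact (imp_congr (ih₁ h₁ w) (ih₂ h₂ w)).trans (w.bool.imp φ ψ).symm
  | box i φ ih =>
    have ih := ih ((Set.subset_insert _ _).trans hφ)
    constructor
    · intro h
      by_contra hcon
      obtain ⟨u, hu, hu'⟩ := w.exists_of_not_holds_box hcon
      exact hu' ((ih u).1 (h u fun ψ _ => hu ψ))
    · exact fun h u hu =>
        (ih u).2 (u.holds_of_isAxiom (.boxT i φ) (hu φ (hφ (self_mem_closure _)) h))
  | common φ ih =>
    obtain ⟨hC, h'⟩ := Set.union_subset_iff.1 ((Set.subset_insert _ _).trans hφ)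
    have ih := ih h'
    constructor
    · exact fun h => holds_common_of_forall_reach hΓ fun u hu => (ih u).1 (h u hu)
    · intro h u hu
      have step {v u : CanonicalWorld I} (hv : v.holds (common φ))
          (hvu : ∃ i, (filtratedModel Γ).rel i v u) : u.holds (common φ) ∧ u.holds φ := by
        obtain ⟨i, hi⟩ := hvu
        have hu : u.holds (common φ) := u.holds_of_isAxiom (.boxT i _)
          (hi (common φ) (hC ⟨i, rfl⟩) (v.holds_of_common hv i).2)
        exact ⟨hu, u.holds_of_isAxiom (.boxT i φ) (u.holds_of_common hu i).1⟩
      suffices H : u.holds (common φ) ∧ u.holds φ from (ih u).2 H.2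
      induction hu with
      | single hu => exact step h hu
      | tail _ hbc ih => exact step ih.1 hbc

/-- Completeness for Kripke models with reflexive and transitive relations. -/
theorem provable_of_valid [Nonempty I] {φ : Formula I}
    (h : ∀ (M : KripkeModel I) (w : M.World), M.Sat w φ) : Provable φ :=
  provable_of_forall_holds fun w =>
    (truth_lemma (finite_closure φ) subset_rfl w).1 (h (filtratedModel (closure φ)) w)

theorem Provable.globalDerivable {φ : Formula I} (h : Provable φ) :
    GlobalDerivable (∅ : Set (Formula I)) φ := by
  induction h with
  | ax φ h => exact ⟨.leaf φ, fun _ hχ => hχ.2 (hχ.1 ▸ h)⟩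
  | mp φ ψ _ _ ih₁ ih₂ =>
    obtain ⟨d, hd⟩ := ih₁
    obtain ⟨e, he⟩ := ih₂
    exact ⟨.mp φ ψ d e, Set.union_subset hd he⟩
  | nec φ _ ih =>
    obtain ⟨d, hd⟩ := ih
    exact ⟨.nec φ d, hd⟩

end S4C

theorem mainTheorem6 {I : Type*} [Fintype I] [Nonempty I] :
    (∀ φ : S4C.Formula I, S4C.Provable φ ↔ S4C.GlobalDerivable (∅ : Set (S4C.Formula I)) φ) ∧
    (∀ (φ : ℕ → S4C.Formula I) (ψ : S4C.Formula I),
      (∀ n : ℕ, S4C.Provable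
        (.imp (φ n) (.and (.everyone ψ) (.everyone (φ (n + 1)))))) →
      S4C.Provable (.imp (φ 0) (.common ψ))) := by
  have sound (φ : S4C.Formula I) (h : S4C.Provable φ) (M : S4C.KripkeModel I) (w : M.World) :
      M.Sat w φ := h.globalDerivable.sat M w
  exact ⟨fun φ => ⟨fun h => h.globalDerivable, fun h => S4C.provable_of_valid h.sat⟩,
    fun φ ψ h => S4C.provable_of_valid fun M => M.sat_omega fun n => sound _ (h n) M⟩
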